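/- Let $G$ be a Hausdorff topological group with identity $e$ that is NSS, i.e. some open neighbourhood of $e$ contains no nontrivial subgroup of $G$. Let $X$ be a Tychonoff (completely regular $T_1$) space that is $G$-regular, i.e. for every closed set $F\subseteq X$ and every point $x\in X\setminus F$ there exist a continuous function $f:X\to G$ and $g\in G\setminus\{e\}$ with $f(x)=g$ and $f(F)\subseteq\{e\}$. Let $C_p(X,G)$ denote the group of all continuous functions $X\to G$ with pointwise operations, endowed with the topology of pointwise convergence. A subset $A$ of a topological group $H$ is called absolutely productive in $H$ if for every injection $a:\mathbb{N}\to A$ and every map $z:\mathbb{N}\to\mathbb{Z}$ the sequence of ordered products $\prod_{n=0}^{k}a(n)^{z(n)}=a(0)^{z(0)}a(1)^{z(1)}\cdots a(k)^{z(k)}$ $(k\in\mathbb{N})$ converges to some element of $H$; the group $H$ is called TAP if every absolutely productive set in $H$ is finite. Then the following conditions are equivalent: (i) $X$ is pseudocompact, i.e. every continuous function $X\to\mathbb{R}$ is bounded; (ii) $C_p(X,G)$ is TAP; (iii) $C_p(X,G)$ has no subgroup that, with the subspace topology, is topologically isomorphic to a product $\prod_{i\in I}H_i$ (with the product topology) of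 nontrivial Hausdorff topological groups $H_i$ over an infinite index set $I$. -/

import Mathlib

open Filter Topology

universe u v w w'

/-- `C_p(X, G)`: the group of continuous functions `X → G` under pointwise operations, as a
subgroup of `X → G`. Its topology is the subspace topology of the product topology on `X → G`,
that is, the topology of pointwise convergence. -/
abbrev Cp (X : Type*) (G : Type*) [TopologicalSpace X] [TopologicalSpace G] [Group G]
    [IsTopologicalGroup G] : Type _ :=
  continuousSubgroup X G

/-- The topology of `C_p(X, G)` has the sets `W(x, U) = {f | f x ∈ U}`, with `x` a point of `X`
and `U` open in `G`, as a subbase. -/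
theorem Cp.topology_eq (X : Type*) (G : Type*) [TopologicalSpace X] [TopologicalSpace G] [Group G]
    [IsTopologicalGroup G] :
    (inferInstance : TopologicalSpace (Cp X G)) =
      TopologicalSpace.generateFrom
        {W | ∃ (x : X) (U : Set G), IsOpen U ∧ W = {f : Cp X G | f.1 x ∈ U}} := by
  apply le_antisymm
  · refine le_generateFrom ?_
    rintro W ⟨x, U, hU, rfl⟩
    exact hU.preimage ((continuous_apply x).comp continuous_subtype_val)
  · refine continuous_iff_le_induced.1 ?_
    refine @continuous_pi _ _ _ (_) _ _ fun x => ?_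
    refine @Continuous.mk _ _ (_) _ _ fun U hU => ?_
    exact TopologicalSpace.isOpen_generateFrom_of_mem ⟨x, U, hU, rfl⟩

/-- Every continuous real-valued function on `X` is bounded. -/
def Pseudocompact (X : Type*) [TopologicalSpace X] : Prop :=
  ∀ f : C(X, ℝ), ∃ M : ℝ, ∀ x : X, |f x| ≤ M

/-- Some open neighbourhood of the identity contains no nontrivial subgroup. -/
def IsNSS (G : Type*) [TopologicalSpace G] [Group G] : Prop :=
  ∃ U : Set G, IsOpen U ∧ (1 : G) ∈ U ∧ ∀ K : Subgroup G, (K : Set G) ⊆ U → K = ⊥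

/-- `X` is `G`-regular. -/
def IsGRegular (X : Type*) (G : Type*) [TopologicalSpace X] [TopologicalSpace G] [Group G]
    [IsTopologicalGroup G] : Prop :=
  ∀ (F : Set X), IsClosed F → ∀ x : X, x ∉ F →
    ∃ (f : Cp X G) (g : G), g ≠ 1 ∧ f.1 x = g ∧ f.1 '' F ⊆ {1}

/-- `A` is absolutely productive: for every injection `a : ℕ → A` and every `z : ℕ → ℤ`, the
ordered partial products `a 0 ^ z 0 * a 1 ^ z 1 * ⋯ * a k ^ z k` converge as `k → ∞`. -/
def AbsolutelyProductive {G : Type*} [TopologicalSpace G] [Group G] (A : Set G) : Prop :=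
  ∀ a : ℕ → G, Function.Injective a → (∀ n, a n ∈ A) → ∀ z : ℕ → ℤ,
    ∃ g : G, Tendsto (fun k : ℕ => ((List.range (k + 1)).map fun n => a n ^ z n).prod)
      atTop (𝓝 g)

/-- Every absolutely productive subset is finite. -/
def IsTAP (G : Type*) [TopologicalSpace G] [Group G] : Prop :=
  ∀ A : Set G, AbsolutelyProductive A → A.Finite

/-- Some subgroup `K` of `G` is topologically isomorphic to the product, with the product
topology, of an infinite family of nontrivial Hausdorff topological groups. -/
def ContainsInfiniteProduct.{w₁, w₂, w₃} (G : Type w₃) [TopologicalSpace G] [Group G] : Prop :=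
  ∃ (ι : Type w₁) (H : ι → Type w₂) (_ : ∀ i, Group (H i)) (_ : ∀ i, TopologicalSpace (H i)),
    Infinite ι ∧ (∀ i, IsTopologicalGroup (H i)) ∧ (∀ i, T2Space (H i)) ∧
    (∀ i, Nontrivial (H i)) ∧ ∃ K : Subgroup G, Nonempty ((∀ i, H i) ≃ₜ* K)

/-! ### A metrizable shadow of an NSS group. -/

open scoped Uniformity Pointwise

/-! (i) → (ii): along a sequence `a n ≠ 1` in an infinite absolutely productive set, NSS makes the
values at each point eventually trivial. Choose `x n` with `a n` nontrivial at `x n`. The countable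
group generated by the `a n` maps `X` into a metrizable space, where by pseudocompactness some
subsequence of the `x n` converges to the image of a point `y`. Build a product of powers such that,
at the point attached to each factor, that factor lies outside `U`, the product of the earlier ones
is near 1 and the later ones equal 1. The limit is 1 at `y` and factors through the metrizable
image, so it must tend to 1 along these points, which it cannot.

(ii) → (iii): one nontrivial element from each factor of an infinite product gives an infinite
absolutely productive set.

(iii) → (i): an unbounded function yields a discrete sequence of open sets; functions supported in
them generate a product of cyclic groups. -/

theorem exists_symm_nhds_one_seq {G : Type*} [TopologicalSpace G] [Group G] [IsTopologicalGroup G]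
    {U : Set G} (hU : U ∈ 𝓝 (1 : G)) :
    ∃ W : ℕ → Set G, (∀ n, W n ∈ 𝓝 1) ∧ (∀ n, (W n)⁻¹ = W n) ∧
      (∀ n, W (n + 1) * W (n + 1) ⊆ W n) ∧ W 0 * W 0 ⊆ U := by
  choose f hf _ hinv hmul using
    fun V : {V : Set G // V ∈ 𝓝 (1 : G)} => exists_closed_nhds_one_inv_eq_mul_subset V.2
  let W : ℕ → {V : Set G // V ∈ 𝓝 (1 : G)} := fun n =>
    Nat.rec ⟨f ⟨U, hU⟩, hf _⟩ (fun _ V => ⟨f V, hf _⟩) n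
  refine ⟨fun n => (W n).1, fun n => (W n).2, fun n => ?_, fun n => hmul (W n), hmul ⟨U, hU⟩⟩
  cases n with
  | zero => exact hinv ⟨U, hU⟩
  | succ n => exact hinv (W n)

/-- A decreasing sequence of symmetric sets with `W (n + 1) * W (n + 1) ⊆ W n` generates a left
invariant uniformity. -/
theorem exists_uniformSpace_hasBasis {G : Type*} [Group G] (W : ℕ → Set G) (h1 : ∀ n, 1 ∈ W n)
    (hinv : ∀ n, (W n)⁻¹ = W n) (hmul : ∀ n, W (n + 1) * W (n + 1) ⊆ W n) :
    ∃ _ : UniformSpace G, (𝓤 G).HasBasis (fun _ : ℕ => True)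
      fun n => {p : G × G | p.1⁻¹ * p.2 ∈ W n} := by
  have hanti : Antitone W := antitone_nat_of_succ_le fun n x hx =>
    hmul n ⟨x, hx, 1, h1 _, mul_one x⟩
  let D : ℕ → Set (G × G) := fun n => {p : G × G | p.1⁻¹ * p.2 ∈ W n}
  have hD : Antitone D := fun m n hmn p hp => hanti hmn hp
  have hb : (⨅ n, 𝓟 (D n)).HasBasis (fun _ : ℕ => True) D :=
    hasBasis_iInf_principal (directed_of_isDirected_le hD)
  refine ⟨UniformSpace.ofCore
    { uniformity := ⨅ n, 𝓟 (D n)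
      refl := ?_
      symm := ?_
      comp := ?_ }, hb⟩
  · refine hb.ge_iff.2 fun n _ => ?_
    rintro ⟨a, b⟩ (rfl : a = b)
    simpa [D] using h1 n
  · refine hb.tendsto_right_iff.2 fun n _ => ?_
    filter_upwards [hb.mem_of_mem (i := n) trivial] with p hp
    have : (p.1⁻¹ * p.2)⁻¹ ∈ W n := by
      rw [← hinv n]
      exact Set.inv_mem_inv.2 hp
    simpa [D] using this
  · refine hb.ge_iff.2 fun n _ => ?_
    refine mem_of_superset (mem_lift' (hb.mem_of_mem (i := n + 1) trivial)) ?_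
    rintro ⟨a, c⟩ ⟨b, hab, hbc⟩
    have := hmul n ⟨_, hab, _, hbc, rfl⟩
    simpa [D, mul_assoc] using this

/-- An NSS group admits a continuous injection into a metrizable uniform space that controls left
translations near the identity. -/
theorem exists_injective_continuous_of_noSmallSubgroup {G : Type u} [TopologicalSpace G] [Group G]
    [IsTopologicalGroup G] {U : Set G} (hU : U ∈ 𝓝 (1 : G))
    (hUK : ∀ K : Subgroup G, (K : Set G) ⊆ U → K = ⊥) :
    ∃ (M : Type u) (_ : UniformSpace M) (_ : IsCountablyGenerated (𝓤 M)) (_ : T0Space M)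
      (i : G → M), Continuous i ∧ Function.Injective i ∧
        ∃ V ∈ 𝓝 (i 1), ∀ a b, i a ∈ V → i (a * b) ∈ V → b ∈ U := by
  obtain ⟨W, hW, hinv, hmul, h0⟩ := exists_symm_nhds_one_seq hU
  have h1 : ∀ n, (1 : G) ∈ W n := fun n => mem_of_mem_nhds (hW n)
  let K : Subgroup G :=
    { carrier := ⋂ n, W n
      mul_mem' := fun {a b} ha hb => Set.mem_iInter.2 fun n =>
        hmul n ⟨a, Set.mem_iInter.1 ha _, b, Set.mem_iInter.1 hb _, rfl⟩
      one_mem' := Set.mem_iInter.2 h1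
      inv_mem' := fun {a} ha => Set.mem_iInter.2 fun n => by
        rw [← hinv n]
        exact Set.inv_mem_inv.2 (Set.mem_iInter.1 ha n) }
  have hK : K = ⊥ := hUK K fun x hx =>
    h0 ⟨x, Set.mem_iInter.1 hx 0, 1, h1 0, mul_one x⟩
  -- An opaque copy of `G`, so that the new uniformity does not clash with the given topology.
  obtain ⟨M, hM⟩ : ∃ M : Type u, M = G := ⟨G, rfl⟩
  obtain ⟨e⟩ : Nonempty (G ≃ M) := ⟨Equiv.cast hM.symm⟩
  let : Group M := e.symm.group
  have he1 : e 1 = 1 := (e.symm.mulEquiv).symm.map_one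
  have hes : ∀ a, e.symm a⁻¹ = (e.symm a)⁻¹ := (e.symm.mulEquiv).map_inv
  have hesm : ∀ a b, e.symm (a * b) = e.symm a * e.symm b := (e.symm.mulEquiv).map_mul
  have hes1 : e.symm 1 = 1 := (e.symm.mulEquiv).map_one
  obtain ⟨uM, hb⟩ := exists_uniformSpace_hasBasis (fun n => e.symm ⁻¹' W n)
    (fun n => by simpa [hes1] using h1 n)
    (fun n => by
      ext x
      simp only [Set.mem_inv, Set.mem_preimage, hes]
      rw [← Set.mem_inv, hinv])
    (fun n => by
      rintro _ ⟨a, ha, b, hb, rfl⟩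
      simp only [Set.mem_preimage, hesm]
      exact hmul n ⟨_, ha, _, hb, rfl⟩)
  refine ⟨M, uM, hb.isCountablyGenerated, ?_, e, ?_, e.injective, ?_⟩
  · refine t0Space_iff_uniformity.2 fun x y h => ?_
    have : e.symm (x⁻¹ * y) ∈ K := Set.mem_iInter.2 fun n => h _ (hb.mem_of_mem (i := n) trivial)
    rw [hK, Subgroup.mem_bot, hesm, hes, inv_mul_eq_one] at this
    exact e.symm.injective this
  · refine continuous_iff_continuousAt.2 fun a => ?_
    refine (nhds_basis_uniformity' hb).tendsto_right_iff.2 fun n _ => ?_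
    have : Tendsto (fun x => a⁻¹ * x) (𝓝 a) (𝓝 1) := by
      simpa using (continuous_const_mul a⁻¹).tendsto a
    filter_upwards [this (hW n)] with x hx
    simpa [UniformSpace.ball, hesm, hes] using hx
  · refine ⟨_, (nhds_basis_uniformity' hb).mem_of_mem (i := 0) trivial, fun a b ha hab => h0 ?_⟩
    simp only [UniformSpace.ball, Set.mem_preimage, Set.mem_ofPred_eq, hesm, hes, he1, hes1,
      Equiv.symm_apply_apply, inv_one, one_mul] at ha hab
    refine ⟨a⁻¹, ?_, a * b, hab, by simp⟩
    rw [← hinv 0]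
    exact Set.inv_mem_inv.2 ha

/-! ### Sequences in pseudocompact spaces. -/

/-- Under a continuous map from a pseudocompact space to a pseudometrizable space, the image of
every sequence has a subsequence converging to a point of the range. -/
theorem Pseudocompact.exists_tendsto_subseq {X Y : Type*} [TopologicalSpace X] [TopologicalSpace Y]
    [TopologicalSpace.PseudoMetrizableSpace Y] (hX : Pseudocompact X) {F : X → Y}
    (hF : Continuous F) (x : ℕ → X) :
    ∃ (y : X) (φ : ℕ → ℕ), StrictMono φ ∧ Tendsto (fun n => F (x (φ n))) atTop (𝓝 (F y)) := by
  let := TopologicalSpace.pseudoMetrizableSpacePseudoMetric Y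
  by_contra hcon
  let T : ℕ → Set Y := fun N => (fun n => F (x n)) '' Set.Ici N
  have hT : ∀ N, (T N).Nonempty := fun N => ⟨_, N, Set.self_mem_Ici, rfl⟩
  -- The sum over `N` vanishes only where `F p` is a cluster point of the sequence. At `x n` the
  -- terms with `N ≤ n` vanish, so the reciprocal of the sum is at least `2 ^ n`.
  let g : ℕ → X → ℝ := fun N p => (1 / 2) ^ N * min 1 (Metric.infDist (F p) (T N))
  have hg0 : ∀ N p, 0 ≤ g N p := fun N p =>
    mul_nonneg (by positivity) (le_min zero_le_one Metric.infDist_nonneg)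
  have hg1 : ∀ N p, g N p ≤ (1 / 2 : ℝ) ^ N := fun N p =>
    mul_le_of_le_one_right (by positivity) (min_le_left _ _)
  have hsum : ∀ p, Summable fun N => g N p := fun p =>
    Summable.of_nonneg_of_le (fun N => hg0 N p) (fun N => hg1 N p) summable_geometric_two
  have hpos : ∀ p, 0 < ∑' N, g N p := by
    intro p
    obtain ⟨N, hN⟩ : ∃ N, Metric.infDist (F p) (T N) ≠ 0 := by
      by_contra! h
      refine hcon ⟨p, MapClusterPt.tendsto_subseq (u := fun n => F (x n)) ?_⟩
      refine Metric.nhds_basis_ball.mapClusterPt_iff_frequently.2 fun ε hε => ?_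
      refine frequently_atTop.2 fun N => ?_
      obtain ⟨_, ⟨n, hn, rfl⟩, hd⟩ := (Metric.infDist_lt_iff (hT N)).1 ((h N).trans_lt hε)
      exact ⟨n, hn, by simpa [dist_comm] using hd⟩
    refine (hsum p).tsum_pos (fun N => hg0 N p) N ?_
    exact mul_pos (by positivity)
      (lt_min one_pos (lt_of_le_of_ne Metric.infDist_nonneg (Ne.symm hN)))
  have hcont : Continuous fun p => ∑' N, g N p := by
    refine continuous_tsum (fun N => ?_) summable_geometric_two fun N p => ?_
    · exact continuous_const.mul
        (continuous_const.min ((Metric.continuous_infDist_pt _).comp hF))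
    · rw [Real.norm_of_nonneg (hg0 N p)]
      exact hg1 N p
  obtain ⟨B, hB⟩ := hX ⟨fun p => (∑' N, g N p)⁻¹, hcont.inv₀ fun p => (hpos p).ne'⟩
  obtain ⟨n, hn⟩ := pow_unbounded_of_one_lt B (one_lt_two (α := ℝ))
  have hle : ∑' N, g N (x n) ≤ (1 / 2) ^ n := by
    have hz : ∀ N ∈ Finset.range (n + 1), g N (x n) = 0 := by
      intro N hN
      have hmem : F (x n) ∈ T N := ⟨n, by simpa [Nat.lt_succ_iff] using hN, rfl⟩
      simp [g, Metric.infDist_zero_of_mem hmem]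
    rw [← (hsum (x n)).sum_add_tsum_nat_add (n + 1), Finset.sum_eq_zero hz, zero_add]
    have hs : Summable fun k : ℕ => (1 / 2 : ℝ) ^ (k + (n + 1)) :=
      (summable_nat_add_iff (n + 1)).2 summable_geometric_two
    calc ∑' k, g (k + (n + 1)) (x n) ≤ ∑' k : ℕ, (1 / 2 : ℝ) ^ (k + (n + 1)) :=
          ((summable_nat_add_iff (n + 1)).2 (hsum (x n))).tsum_le_tsum (fun k => hg1 _ _) hs
      _ = (1 / 2) ^ n := by
          simp_rw [pow_add _ _ (n + 1)]
          rw [tsum_mul_right, tsum_geometric_two, pow_succ]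
          ring
  have h2 := (le_abs_self _).trans (hB (x n))
  have h3 : (2 : ℝ) ^ n ≤ (∑' N, g N (x n))⁻¹ := by
    rw [le_inv_comm₀ (by positivity) (hpos _)]
    simpa using hle
  exact absurd (h3.trans h2) (not_le.2 hn)

/-- On a pseudocompact space, a continuous map that factors through a map `F` into a metrizable
space preserves the convergence of sequences tested by `F`. -/
theorem Pseudocompact.tendsto_of_factors {X Y Z : Type*} [TopologicalSpace X] [TopologicalSpace Y]
    [TopologicalSpace.PseudoMetrizableSpace Y] [T2Space Y] [TopologicalSpace Z]
    [TopologicalSpace.PseudoMetrizableSpace Z] (hX : Pseudocompact X) {F : X → Y}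
    (hF : Continuous F) {f : X → Z} (hf : Continuous f) (hfF : ∀ p q, F p = F q → f p = f q)
    {x : ℕ → X} {y : X} (hx : Tendsto (fun n => F (x n)) atTop (𝓝 (F y))) :
    Tendsto (fun n => f (x n)) atTop (𝓝 (f y)) := by
  refine tendsto_of_subseq_tendsto fun ns hns => ?_
  obtain ⟨q, φ, hφ, hq⟩ := hX.exists_tendsto_subseq (hF.prodMk hf) fun n => x (ns n)
  rw [nhds_prod_eq] at hq
  have h1 : Tendsto (fun n => F (x (ns (φ n)))) atTop (𝓝 (F q)) := tendsto_fst.comp hq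
  have h2 : Tendsto (fun n => F (x (ns (φ n)))) atTop (𝓝 (F y)) :=
    hx.comp (hns.comp hφ.tendsto_atTop)
  refine ⟨φ, ?_⟩
  rw [hfF y q (tendsto_nhds_unique h2 h1)]
  exact tendsto_snd.comp hq

/-! ### Absolutely productive sets and the TAP property. -/

theorem prod_map_range_eq_of_le {G : Type*} [Monoid G] {b : ℕ → G} {N : ℕ}
    (h : ∀ n, N ≤ n → b n = 1) {k : ℕ} (hk : N ≤ k) :
    ((List.range k).map b).prod = ((List.range N).map b).prod := by
  induction k, hk using Nat.le_induction with
  | base => rfl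
  | succ k hk ih => simp [List.range_succ, ih, h k hk]

theorem tendsto_prod_map_range {G : Type*} [Monoid G] [TopologicalSpace G] {b : ℕ → G} {N : ℕ}
    (h : ∀ n, N ≤ n → b n = 1) :
    Tendsto (fun k => ((List.range (k + 1)).map b).prod) atTop
      (𝓝 ((List.range N).map b).prod) := by
  refine tendsto_const_nhds.congr' ?_
  filter_upwards [eventually_ge_atTop N] with k hk
  exact (prod_map_range_eq_of_le h (by lia)).symm

theorem tendsto_one_of_tendsto_prod {G : Type*} [TopologicalSpace G] [Group G]
    [IsTopologicalGroup G] {b : ℕ → G} {g : G}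
    (h : Tendsto (fun k => ((List.range (k + 1)).map b).prod) atTop (𝓝 g)) :
    Tendsto b atTop (𝓝 1) := by
  refine (tendsto_add_atTop_iff_nat 1).1 ?_
  have h' := h.inv.mul (h.comp (tendsto_add_atTop_nat 1))
  rw [inv_mul_cancel] at h'
  refine h'.congr fun k => ?_
  simp [List.range_succ (n := k + 1)]

theorem exists_zpow_notMem {G : Type*} [Group G] {U : Set G}
    (hUK : ∀ K : Subgroup G, (K : Set G) ⊆ U → K = ⊥) {g : G} (hg : g ≠ 1) :
    ∃ z : ℤ, g ^ z ∉ U := by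
  by_contra! h
  refine hg (Subgroup.zpowers_eq_bot.1 (hUK (Subgroup.zpowers g) ?_))
  rintro _ ⟨z, rfl⟩
  exact h z

/-- Exponents can push every nontrivial value out of `U`, yet the factors of a convergent product
tend to 1. -/
theorem AbsolutelyProductive.eventually_apply_eq_one {X G : Type*} [TopologicalSpace X]
    [TopologicalSpace G] [Group G] [IsTopologicalGroup G] {U : Set G} (hU : U ∈ 𝓝 (1 : G))
    (hUK : ∀ K : Subgroup G, (K : Set G) ⊆ U → K = ⊥) {A : Set (Cp X G)}
    (hA : AbsolutelyProductive A) {a : ℕ → Cp X G} (ha : Function.Injective a)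
    (haA : ∀ n, a n ∈ A) (x : X) : ∃ N, ∀ n, N ≤ n → (a n).1 x = 1 := by
  have hz : ∀ n, ∃ z : ℤ, (a n).1 x ≠ 1 → (a n).1 x ^ z ∉ U := fun n => by
    by_cases h : (a n).1 x = 1
    · exact ⟨0, fun h' => absurd h h'⟩
    · obtain ⟨z, hz⟩ := exists_zpow_notMem hUK h
      exact ⟨z, fun _ => hz⟩
  choose z hz using hz
  obtain ⟨g, hg⟩ := hA a ha haA z
  have h1 : Tendsto (fun n => ((a n ^ z n : Cp X G)).1 x) atTop (𝓝 ((1 : Cp X G).1 x)) :=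
    (((continuous_apply x).comp continuous_subtype_val).tendsto _).comp
      (tendsto_one_of_tendsto_prod hg)
  obtain ⟨N, hN⟩ := eventually_atTop.1 (h1.eventually_mem (show U ∈ 𝓝 (1 : G) from hU))
  refine ⟨N, fun n hn => ?_⟩
  by_contra h
  exact hz n h (hN n hn)

theorem isTAP_Cp_of_pseudocompact {G : Type*} [TopologicalSpace G] [Group G]
    [IsTopologicalGroup G] [T2Space G] (hG : IsNSS G) {X : Type*} [TopologicalSpace X]
    (hX : Pseudocompact X) : IsTAP (Cp X G) := by
  intro A hA
  by_contra hinf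
  obtain ⟨U, hUo, hU1, hUK⟩ := hG
  have hU : U ∈ 𝓝 (1 : G) := hUo.mem_nhds hU1
  obtain ⟨M, _, _, _, i, hi, hinj, V, hV, hVU⟩ :=
    exists_injective_continuous_of_noSmallSubgroup hU hUK
  have hinf' : (A \ {1}).Infinite := Set.Infinite.sdiff hinf (Set.finite_singleton 1)
  obtain ⟨a, ha, haA⟩ : ∃ a : ℕ → Cp X G, Function.Injective a ∧ ∀ n, a n ∈ A \ {1} :=
    ⟨fun n => (hinf'.natEmbedding _ n).1,
      Subtype.val_injective.comp (hinf'.natEmbedding _).injective,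
      fun n => (hinf'.natEmbedding _ n).2⟩
  have hne : ∀ n, ∃ x, (a n).1 x ≠ 1 := fun n => by
    by_contra! h
    exact (haA n).2 (Subtype.ext (funext h))
  choose x hx using hne
  have hfin := hA.eventually_apply_eq_one hU hUK ha fun n => (haA n).1
  let S : Subgroup (Cp X G) := (FreeGroup.lift a).range
  have haS : ∀ n, a n ∈ S := fun n => ⟨FreeGroup.of n, by simp⟩
  have : Countable (FreeGroup ℕ) := Quot.mk_surjective.countable
  have : Countable S := (FreeGroup.lift a).rangeRestrict_surjective.countable
  let F : X → S → M := fun p s => i (s.1.1 p)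
  have hF : Continuous F := continuous_pi fun s => hi.comp s.1.2
  obtain ⟨y, φ, hφ, hy⟩ := hX.exists_tendsto_subseq hF x
  obtain ⟨N₀, hN₀⟩ := hfin y
  -- the step of the recursion: extend a finite product `P` by a power of some `a (φ n)`
  have step : ∀ t : {P : Cp X G // P ∈ S ∧ P.1 y = 1} × ℕ, ∃ (n N : ℕ) (z : ℤ),
      t.2 ≤ φ n ∧ N₀ ≤ φ n ∧ φ n < N ∧ i (t.1.1.1 (x (φ n))) ∈ V ∧
      (a (φ n)).1 (x (φ n)) ^ z ∉ U ∧ ∀ l, N ≤ l → (a l).1 (x (φ n)) = 1 := by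
    rintro ⟨⟨P, hPS, hPy⟩, m⟩
    have hlim : Tendsto (fun n => i (P.1 (x (φ n)))) atTop (𝓝 (i 1)) := by
      have := tendsto_pi_nhds.1 hy ⟨P, hPS⟩
      simpa only [F, hPy] using this
    obtain ⟨n, hn1, hn2, hn3⟩ := ((hlim.eventually_mem hV).and
      ((hφ.tendsto_atTop.eventually_ge_atTop m).and
        (hφ.tendsto_atTop.eventually_ge_atTop N₀))).exists
    obtain ⟨z, hz⟩ := exists_zpow_notMem hUK (hx (φ n))
    obtain ⟨N, hN⟩ := hfin (x (φ n))
    -- The maximum makes the chosen indices strictly increase.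
    exact ⟨n, max N (φ n + 1), z, hn2, hn3, by simp, hn1, hz,
      fun l hl => hN l ((le_max_left _ _).trans hl)⟩
  choose n N z hn hn₀ hnN hnV hnU hnl using step
  let st : ℕ → {P : Cp X G // P ∈ S ∧ P.1 y = 1} × ℕ := fun k =>
    Nat.rec ⟨⟨1, S.one_mem, rfl⟩, 0⟩
      (fun _ t => ⟨⟨t.1.1 * a (φ (n t)) ^ z t, S.mul_mem t.1.2.1 (S.zpow_mem (haS _) _), by
        have h1 : t.1.1.1 y = 1 := t.1.2.2
        have h2 : (a (φ (n t))).1 y = 1 := hN₀ _ (hn₀ t)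
        simp [h1, h2]⟩, N t⟩) k
  let σ : ℕ → ℕ := fun k => φ (n (st k))
  have hσ : StrictMono σ := strictMono_nat_of_lt_succ fun k =>
    (hnN (st k)).trans_le (hn (st (k + 1)))
  have hst : ∀ k, ((List.range k).map fun j => a (σ j) ^ z (st j)).prod = (st k).1.1 := by
    intro k
    induction k with
    | zero => rfl
    | succ k ih =>
      rw [List.range_succ, List.map_append, List.prod_append, ih]
      simp only [List.map_cons, List.map_nil, List.prod_singleton]
      rfl
  obtain ⟨f, hf⟩ := hA (fun k => a (σ k)) (ha.comp hσ.injective) (fun k => (haA _).1)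
    fun k => z (st k)
  simp_rw [hst] at hf
  have hfp : ∀ p, Tendsto (fun k => (st (k + 1)).1.1.1 p) atTop (𝓝 (f.1 p)) := fun p =>
    (((continuous_apply p).comp continuous_subtype_val).tendsto _).comp hf
  have hfy : f.1 y = 1 := tendsto_nhds_unique (hfp y) <| by
    simpa only [(st _).1.2.2] using tendsto_const_nhds
  have hfx : ∀ k, f.1 (x (σ k)) = (st (k + 1)).1.1.1 (x (σ k)) := by
    intro k
    refine tendsto_nhds_unique (hfp _) (tendsto_const_nhds.congr' ?_)
    filter_upwards [eventually_ge_atTop k] with m hm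
    induction m, hm using Nat.le_induction with
    | base => rfl
    | succ m hm ih =>
      have hNl : N (st k) ≤ σ (m + 1) :=
        (hn (st (k + 1))).trans (hσ.monotone (Nat.succ_le_succ hm))
      have h1 : (a (σ (m + 1))).1 (x (σ k)) = 1 := hnl (st k) _ hNl
      have h2 : (st (m + 1 + 1)).1.1.1 (x (σ k)) =
        (st (m + 1)).1.1.1 (x (σ k)) * (a (σ (m + 1))).1 (x (σ k)) ^ z (st (m + 1)) := rfl
      rw [h2, h1, one_zpow, mul_one]
      exact ih
  -- `f` is a pointwise limit of members of `S`, whose values are determined by `F`.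
  have hfF : ∀ p q, F p = F q → i (f.1 p) = i (f.1 q) := fun p q hpq => by
    congr 1
    refine tendsto_nhds_unique (hfp p) ((hfp q).congr fun k => hinj ?_)
    exact (congrFun hpq ⟨_, (st (k + 1)).1.2.1⟩).symm
  have hτ : StrictMono fun k => n (st k) := fun k l hkl => hφ.lt_iff_lt.1 (hσ hkl)
  have hlim := (hX.tendsto_of_factors hF (hi.comp f.2) hfF hy).comp hτ.tendsto_atTop
  obtain ⟨k, hk⟩ := (hlim.eventually_mem (show V ∈ 𝓝 (i (f.1 y)) by rwa [hfy])).exists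
  have hk' : i (f.1 (x (σ k))) ∈ V := hk
  rw [hfx] at hk'
  exact hnU (st k) (hVU _ _ (hnV (st k)) hk')

/-! ### Infinite products. -/

theorem not_isTAP_of_containsInfiniteProduct {G : Type*} [TopologicalSpace G] [Group G]
    (h : ContainsInfiniteProduct.{w, w'} G) : ¬ IsTAP G := by
  classical
  obtain ⟨ι, H, _, _, _, _, _, _, K, ⟨e⟩⟩ := h
  choose g hg using fun j => exists_ne (1 : H j)
  let s : ι → G := fun j => (e (Pi.mulSingle j (g j))).1
  have hs : Function.Injective s := by
    intro j k hjk
    have h1 : Pi.mulSingle j (g j) = Pi.mulSingle k (g k) := e.injective (Subtype.ext hjk)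
    by_contra hne
    have h2 := congrFun h1 j
    rw [Pi.mulSingle_eq_same, Pi.mulSingle_eq_of_ne hne] at h2
    exact hg j h2
  intro hT
  refine Set.infinite_range_of_injective hs (hT _ fun a ha haA z => ?_)
  choose m hm using haA
  have hminj : Function.Injective m := fun p q hpq => ha (by rw [← hm p, ← hm q, hpq])
  let b : ℕ → ∀ j, H j := fun n => Pi.mulSingle (m n) (g (m n)) ^ z n
  -- Since `m` is injective, at most one factor is nontrivial in each coordinate.
  have hb : ∀ j, ∃ N, ∀ n, N ≤ n → b n j = 1 := by
    intro j
    by_cases hj : ∃ n, m n = j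
    · obtain ⟨n, rfl⟩ := hj
      refine ⟨n + 1, fun k hk => ?_⟩
      have : m n ≠ m k := fun h => by have := hminj h; lia
      simp [b, Pi.mulSingle_eq_of_ne this]
    · refine ⟨0, fun k _ => ?_⟩
      have : j ≠ m k := fun h => hj ⟨k, h.symm⟩
      simp [b, Pi.mulSingle_eq_of_ne this]
  choose N hN using hb
  let c : ∀ j, H j := fun j => ((List.range (N j)).map fun n => b n j).prod
  have hc : Tendsto (fun k => ((List.range (k + 1)).map b).prod) atTop (𝓝 c) := by
    refine tendsto_pi_nhds.2 fun j => ?_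
    refine (tendsto_prod_map_range (hN j)).congr fun k => ?_
    exact ((map_list_prod (Pi.evalMonoidHom H j) _).trans (by simp [Function.comp_def])).symm
  refine ⟨(e c).1, ?_⟩
  refine (((continuous_subtype_val.comp e.continuous).tendsto c).comp hc).congr fun k => ?_
  have h3 := map_list_prod (K.subtype.comp e.toMulEquiv.toMonoidHom) ((List.range (k + 1)).map b)
  refine h3.trans ?_
  rw [List.map_map]
  congr 2
  funext n
  have h4 : (K.subtype.comp e.toMulEquiv.toMonoidHom) (Pi.mulSingle (m n) (g (m n))) = a n := hm n
  simp only [Function.comp_apply, b, map_zpow, h4]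

/-- Moves countable cyclic groups into the universe prescribed for the factors. -/
theorem exists_continuousMulEquiv_of_small {K : Type*} [Group K] [TopologicalSpace K]
    [IsTopologicalGroup K] [Small.{w} K] :
    ∃ (H : Type w) (_ : Group H) (_ : TopologicalSpace H),
      IsTopologicalGroup H ∧ Nonempty (H ≃ₜ* K) := by
  let e := (equivShrink.{w} K).symm
  let _ : Group (Shrink.{w} K) := e.group
  let _ : TopologicalSpace (Shrink.{w} K) := TopologicalSpace.induced e inferInstance
  exact ⟨Shrink.{w} K, inferInstance, inferInstance, topologicalGroup_induced e.mulEquiv,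
    ⟨{ e.mulEquiv, e.toHomeomorphOfIsInducing ⟨rfl⟩ with }⟩⟩

/-- Nontrivial continuous functions supported in the members of a discrete family of sets yield an
infinite product inside `C_p(X, G)`. -/
theorem containsInfiniteProduct_Cp_of_discrete {X G : Type*} [TopologicalSpace X]
    [TopologicalSpace G] [Group G] [IsTopologicalGroup G] [T2Space G] {ι : Type w} [Infinite ι]
    (U : ι → Set X) (hU : ∀ x, ∃ i, ∀ᶠ x' in 𝓝 x, ∀ j, x' ∈ U j → j = i)
    (h : ι → Cp X G) (hne : ∀ i, h i ≠ 1) (hsupp : ∀ i x, x ∉ U i → (h i).1 x = 1) :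
    ContainsInfiniteProduct.{w, w'} (Cp X G) := by
  classical
  choose H hgrp htop htg hiso using
    fun i => exists_continuousMulEquiv_of_small.{w'} (K := Subgroup.zpowers (h i))
  let e : ∀ i, H i ≃ₜ* Subgroup.zpowers (h i) := fun i => (hiso i).some
  let c : ∀ i, H i →* (X → G) := fun i =>
    ((continuousSubgroup X G).subtype.comp (Subgroup.zpowers (h i)).subtype).comp
      (e i).toMulEquiv.toMonoidHom
  have hc : ∀ i, IsEmbedding (c i) := fun i =>
    IsEmbedding.subtypeVal.comp (IsEmbedding.subtypeVal.comp (e i).toHomeomorph.isEmbedding)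
  have hcc : ∀ i t, Continuous (c i t) := fun i t => ((e i) t).1.2
  have hcU : ∀ i t x, x ∉ U i → c i t x = 1 := by
    intro i t x hx
    obtain ⟨z, hz⟩ := ((e i) t).2
    have h1 : c i t x = (h i).1 x ^ z := congrArg (fun f : Cp X G => f.1 x) hz.symm
    rw [h1, hsupp i x hx, one_zpow]
  have hν : ∀ x, ∃ i, ∀ j, x ∈ U j → j = i := fun x => (hU x).imp fun i hi => hi.self_of_nhds
  -- Where no `U i` contains `x`, the value of `ν x` is irrelevant: every `c i t` is 1 there.
  choose ν hν using hν
  have hcont : ∀ t : ∀ i, H i, Continuous fun x => c (ν x) (t (ν x)) x := by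
    refine fun t => continuous_iff_continuousAt.2 fun x => ?_
    obtain ⟨i, hi⟩ := hU x
    refine (hcc i (t i)).continuousAt.congr ?_
    filter_upwards [hi] with p hp
    by_cases hpi : ν p = i
    · rw [hpi]
    · rw [hcU i _ p fun hm => hpi (hν p i hm).symm, hcU (ν p) _ p fun hm => hpi (hp _ hm)]
  let Ψ : (∀ i, H i) →* Cp X G :=
    { toFun := fun t => ⟨fun x => c (ν x) (t (ν x)) x, hcont t⟩
      map_one' := Subtype.ext <| funext fun x => by simp
      map_mul' := fun s t => Subtype.ext <| funext fun x => by simp }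
  -- Cutting off to each `U i` recovers the coordinates; the result may be discontinuous in `x`,
  -- hence the target.
  let R : Cp X G → ι → X → G := fun f i x => if x ∈ U i then f.1 x else 1
  have hR : Continuous R := by
    refine continuous_pi fun i => continuous_pi fun x => ?_
    by_cases hx : x ∈ U i
    · simpa [R, hx] using (continuous_apply x).comp' continuous_subtype_val
    · simpa [R, hx] using continuous_const
  have hΨ : Continuous Ψ := by
    refine Continuous.subtype_mk (continuous_pi fun x => ?_) _
    exact (continuous_apply x).comp ((hc (ν x)).continuous.comp (continuous_apply (ν x)))
  have hRΨ : R ∘ Ψ = Pi.map fun i => c i := by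
    funext t i x
    by_cases hx : x ∈ U i
    · have : ν x = i := (hν x i hx).symm
      subst this
      simp [R, Ψ, hx]
    · simp [R, hx, hcU i _ x hx]
  have hemb : IsEmbedding Ψ :=
    IsEmbedding.of_comp hΨ hR (hRΨ ▸ IsEmbedding.piMap hc)
  refine ⟨ι, H, hgrp, htop, inferInstance, htg, fun i => (hc i).t2Space, fun i => ?_, Ψ.range, ⟨?_⟩⟩
  · have : Nontrivial (Subgroup.zpowers (h i)) :=
      (Subgroup.nontrivial_iff_ne_bot _).2 fun hb => hne i (Subgroup.zpowers_eq_bot.1 hb)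
    exact (e i).toEquiv.nontrivial
  · exact { MonoidHom.ofInjective hemb.injective, (MonoidHom.ofInjective hemb.injective).toEquiv.toHomeomorphOfIsInducing
      (IsInducing.subtypeVal.of_comp_iff.1 hemb.isInducing) with }

theorem containsInfiniteProduct_Cp_of_not_pseudocompact {X G : Type*} [TopologicalSpace X]
    [TopologicalSpace G] [Group G] [IsTopologicalGroup G] [T2Space G] (hX : IsGRegular X G)
    (hp : ¬ Pseudocompact X) : ContainsInfiniteProduct.{w, w'} (Cp X G) := by
  simp only [Pseudocompact, not_forall, not_exists, not_le] at hp
  obtain ⟨f, hf⟩ := hp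
  choose p hp using hf
  -- Gaps over 4 suffice: a point within 1 of `|f x|` and of `r j` puts `r j` within 2 of `|f x|`,
  -- which only one `j` can satisfy.
  let y : ℕ → X := fun n => Nat.rec (p 0) (fun _ x => p (|f x| + 4)) n
  let r : ℕ → ℝ := fun n => |f (y n)|
  have hr : ∀ n, r n + 4 < r (n + 1) := fun n => hp _
  have hrm : StrictMono r := strictMono_nat_of_lt_succ fun n => by linarith [hr n]
  have hr4 : ∀ m n, m < n → r m + 4 < r n := fun m n hmn =>
    (hr m).trans_le (hrm.monotone hmn)
  have hq : Continuous fun x => |f x| := f.continuous.abs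
  let U : ℕ → Set X := fun n => {x | |f x| ∈ Metric.ball (r n) 1}
  have hUo : ∀ n, IsOpen (U n) := fun n => Metric.isOpen_ball.preimage hq
  have hreg := fun n => hX (U n)ᶜ (hUo n).isClosed_compl (y n)
    (by simp [U, r])
  choose h g hg hhg hsupp using hreg
  refine containsInfiniteProduct_Cp_of_discrete (ι := ULift.{w} ℕ) (fun i => U i.down) (fun x => ?_)
    (fun i => h i.down) (fun i hi => hg i.down ?_) fun i x hx => ?_
  · have hinj : ∀ m n, |r m - r n| < 4 → m = n := fun m n hmn => by
      rw [abs_lt] at hmn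
      rcases lt_trichotomy m n with hlt | heq | hgt
      · linarith [hr4 m n hlt]
      · exact heq
      · linarith [hr4 n m hgt]
    have hnear : ∀ᶠ x' in 𝓝 x, ∀ j, x' ∈ U j → |(|f x| - r j)| < 2 := by
      filter_upwards [hq.continuousAt.eventually (Metric.ball_mem_nhds |f x| one_pos)]
        with x' hx' j hj
      have h1 := abs_lt.1 (Real.dist_eq _ _ ▸ Metric.mem_ball.1 hx')
      have h2 := abs_lt.1 (Real.dist_eq _ _ ▸ Metric.mem_ball.1 hj)
      exact abs_lt.2 ⟨by linarith, by linarith⟩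
    by_cases hk : ∃ k, |(|f x| - r k)| < 2
    · obtain ⟨k, hk⟩ := hk
      refine ⟨⟨k⟩, hnear.mono fun x' hx' j hj => ULift.ext _ _ (hinj _ _ ?_)⟩
      have h1 := abs_lt.1 (hx' _ hj)
      have h2 := abs_lt.1 hk
      exact abs_lt.2 ⟨by linarith, by linarith⟩
    · exact ⟨⟨0⟩, hnear.mono fun x' hx' j hj => absurd ⟨_, hx' _ hj⟩ hk⟩
  · rw [← hhg, hi]
    rfl
  · exact hsupp i.down ⟨x, hx, rfl⟩

theorem mainTheorem1 (G : Type u) [TopologicalSpace G] [Group G]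
    [IsTopologicalGroup G] [T2Space G] (hG : IsNSS G)
    (X : Type v) [TopologicalSpace X] [T35Space X] (hX : IsGRegular X G) :
    List.TFAE
      [Pseudocompact X,
       IsTAP (Cp X G),
       ¬ ContainsInfiniteProduct.{w, w'} (Cp X G)] := by
  tfae_have 1 → 2 := isTAP_Cp_of_pseudocompact hG
  tfae_have 2 → 3 := fun h hc => not_isTAP_of_containsInfiniteProduct hc h
  tfae_have 3 → 1 := fun h => by_contra fun hp =>
    h (containsInfiniteProduct_Cp_of_not_pseudocompact hX hp)
  tfae_finish
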